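/- **Extended Rodrigues formula on nonuniform lattices.** Let $x:\mathbb C\to\mathbb C$ be a nonuniform lattice, i.e. either $x(s)=c_1q^s+c_2q^{-s}+c_3$ with $q\ne 0,1$, $c_1c_2\neq0$ and $q^s$ the principal power, or $x(s)=c_1s^2+c_2s+c_3$ with $c_1\neq 0$ (all constants complex). For $k\in\mathbb Z$ put $x_k(s)=x(s+\tfrac k2)$, and let $$\Delta f(s)=f(s+1)-f(s),\quad \nabla f(s)=f(s)-f(s-1),\quad \Delta_kf(s)=\frac{\Delta f(s)}{\Delta x_k(s)},\quad \nabla_kf(s)=\frac{\nabla f(s)}{\nabla x_k(s)},$$ $$\Delta_k^{(0)}f=f,\qquad \Delta_k^{(n)}f=\Delta_{k+n-1}\cdots\Delta_{k+1}\Delta_kf\quad(n\ge1).$$ For $s\in N+\mathbb Z$ let $\int_N^s g(t)\,d_\nabla x_k(t)=\sum_{t=N}^{s}g(t)\nabla x_k(t)$, where $t$ runs in unit steps, with the usual oriented convention: the sum is $0$ for $s=N-1$ and equals $-\sum_{t=s+1}^{N-1}g(t)\nabla x_k(t)$ for $s=N-2,N-3,\dots$ Let $\tilde\sigma,\tilde\tau$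 be complex polynomials of degree at most $2$ and $1$, let $\lambda\in\mathbb C$, and consider the difference equation of hypergeometric type $$\tilde\sigma[x(s)]\,\Delta_{-1}\nabla_0y(s)+\tfrac12\tilde\tau[x(s)]\bigl(\Delta_0y(s)+\nabla_0y(s)\bigr)+\lambda y(s)=0.\tag{1}$$ Put $\tau(s)=\tilde\tau[x(s)]$, $\sigma(s)=\tilde\sigma[x(s)]-\tfrac12\tilde\tau[x(s)]\nabla x_1(s)$ and $$\tau_k(s)=\frac{\sigma(s+k)-\sigma(s)+\tau(s+k)\nabla x_1(s+k)}{\nabla x_{k+1}(s)},\qquad \lambda_n=-\sum_{j=0}^{n-1}\Delta_j\tau_j(s)$$ (the last sum does not depend on the point $s$; it is taken at $s=N$). Let $N\in\mathbb C$, and suppose that for all $k\in\mathbb Z$ and all $s\in N+\mathbb Z$ we have $\Delta x_k(s)\neq0$, $\sigma(s)\ne0$, $\rho(s)\neq0$, and that $\rho:\mathbb C\to\mathbb C$ satisfies the Pearson type equation $\Delta_{-1}[\sigma(s)\rho(s)]=\tau(s)\rho(s)$ on $N+\mathbb Z$. Let $n\ge0$ be an integer such that $\lambda=\lambda_n$ and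 $\lambda_m\neq\lambda_n$ for $m=0,1,\dots,n-1$. Then the general solution of (1) on $N+\mathbb Z$ is $$y(s)=\frac{C_1}{\rho(s)}\Delta_{-n}^{(n)}\Bigl[\rho(s)\prod_{j=0}^{n-1}\sigma(s-j)\Bigr]+\frac{C_2}{\rho(s)}\Delta_{-n}^{(n)}\Bigl[\rho(s)\prod_{j=0}^{n-1}\sigma(s-j)\int_N^s\frac{d_\nabla x_{-n}(t)}{\rho(t)\prod_{j=0}^{n}\sigma(t-j)}\Bigr].$$ That is, a function $y:\mathbb C\to\mathbb C$ satisfies (1) at every $s\in N+\mathbb Z$ if and only if there are constants $C_1,C_2\in\mathbb C$ for which this formula holds at every $s\in N+\mathbb Z$; moreover the two functions multiplied by $C_1$ and $C_2$ are linearly independent on $N+\mathbb Z$. -/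

import Mathlib

open Polynomial

noncomputable section

namespace NonuniformLattice

/-- The two kinds of nonuniform lattices: `x(s) = c₁ q^s + c₂ q^{-s} + c₃` with `c₁ c₂ ≠ 0`
(`q^s` is the principal power), and `x(s) = c₁ s² + c₂ s + c₃` with `c₁ ≠ 0`. -/
def IsNonuniformLattice (x : ℂ → ℂ) : Prop :=
  (∃ q c₁ c₂ c₃ : ℂ, q ≠ 0 ∧ q ≠ 1 ∧ c₁ * c₂ ≠ 0 ∧
      ∀ s : ℂ, x s = c₁ * q ^ s + c₂ * q ^ (-s) + c₃) ∨
  (∃ c₁ c₂ c₃ : ℂ, c₁ ≠ 0 ∧ ∀ s : ℂ, x s = c₁ * s ^ 2 + c₂ * s + c₃)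

/-- The shifted lattice `x_k(s) = x(s + k/2)`. -/
def shift (x : ℂ → ℂ) (k : ℤ) : ℂ → ℂ := fun s => x (s + (k : ℂ) / 2)

/-- Forward difference `Δ f(s) = f(s+1) - f(s)`. -/
def fwd (f : ℂ → ℂ) : ℂ → ℂ := fun s => f (s + 1) - f s

/-- Backward difference `∇ f(s) = f(s) - f(s-1)`. -/
def bwd (f : ℂ → ℂ) : ℂ → ℂ := fun s => f s - f (s - 1)

/-- `Δ_k f(s) = Δ f(s) / Δ x_k(s)`. -/
def fwdDiv (x : ℂ → ℂ) (k : ℤ) (f : ℂ → ℂ) : ℂ → ℂ :=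
  fun s => fwd f s / fwd (shift x k) s

/-- `∇_k f(s) = ∇ f(s) / ∇ x_k(s)`. -/
def bwdDiv (x : ℂ → ℂ) (k : ℤ) (f : ℂ → ℂ) : ℂ → ℂ :=
  fun s => bwd f s / bwd (shift x k) s

/-- `Δ_k^{(n)} f = Δ_{k+n-1} ⋯ Δ_{k+1} Δ_k f`, and `Δ_k^{(0)} f = f`. -/
def fwdDivIter (x : ℂ → ℂ) (k : ℤ) : ℕ → (ℂ → ℂ) → ℂ → ℂ
  | 0, f => f
  | n + 1, f => fwdDiv x (k + n) (fwdDivIter x k n f)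

/-- The oriented sum `∑_{t=N}^{t=s} f(t)` for `s ∈ N + ℤ`. With `s = N + M` it is
`f(N) + ⋯ + f(N+M)` if `M ≥ 0`, it is `0` if `M = -1`, and it is
`-(f(N+M+1) + ⋯ + f(N-1))` if `M ≤ -2`. It is only used for `s ∈ N + ℤ`, where the
floor below is exactly `M`. -/
def latticeSum (f : ℂ → ℂ) (N s : ℂ) : ℂ :=
  let M : ℤ := ⌊(s - N).re⌋
  ∑ i ∈ Finset.Icc 0 M, f (N + (i : ℂ)) - ∑ i ∈ Finset.Icc (M + 1) (-1), f (N + (i : ℂ))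

/-- The discrete integral `∫_N^s g(t) d_∇ x_k(t) = ∑_{t=N}^{t=s} g(t) ∇ x_k(t)`. -/
def nablaIntegral (x : ℂ → ℂ) (k : ℤ) (g : ℂ → ℂ) (N s : ℂ) : ℂ :=
  latticeSum (fun t => g t * bwd (shift x k) t) N s

/-- `τ(s) = τ̃[x(s)]`. -/
def tau (x : ℂ → ℂ) (τt : ℂ[X]) : ℂ → ℂ := fun s => τt.eval (x s)

/-- `σ(s) = σ̃[x(s)] - (1/2) τ̃[x(s)] ∇ x_1(s)`. -/
def sigma (x : ℂ → ℂ) (σt τt : ℂ[X]) : ℂ → ℂ :=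
  fun s => σt.eval (x s) - 1 / 2 * τt.eval (x s) * bwd (shift x 1) s

/-- `τ_k(s) = (σ(s+k) - σ(s) + τ(s+k) ∇ x_1(s+k)) / ∇ x_{k+1}(s)`. -/
def tauK (x : ℂ → ℂ) (σt τt : ℂ[X]) (k : ℤ) : ℂ → ℂ := fun s =>
  (sigma x σt τt (s + k) - sigma x σt τt s + tau x τt (s + k) * bwd (shift x 1) (s + k)) /
    bwd (shift x (k + 1)) s

/-- `λ_n = - ∑_{j=0}^{n-1} Δ_j τ_j(s)`. On nonuniform lattices the right-hand side does not
depend on `s`; the argument `s` is the point at which it is read off. -/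
def eigenvalue (x : ℂ → ℂ) (σt τt : ℂ[X]) (n : ℕ) (s : ℂ) : ℂ :=
  -∑ j ∈ Finset.range n, fwdDiv x (j : ℤ) (tauK x σt τt (j : ℤ)) s

/-- The difference equation of hypergeometric type at the point `s`:
`σ̃[x(s)] Δ_{-1} ∇_0 y(s) + (1/2) τ̃[x(s)] (Δ_0 y(s) + ∇_0 y(s)) + λ y(s) = 0`. -/
def HypergeometricEqAt (x : ℂ → ℂ) (σt τt : ℂ[X]) (lam : ℂ) (y : ℂ → ℂ) (s : ℂ) : Prop :=
  σt.eval (x s) * fwdDiv x (-1) (bwdDiv x 0 y) s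
    + τt.eval (x s) / 2 * (fwdDiv x 0 y s + bwdDiv x 0 y s) + lam * y s = 0

/-- The Pearson type equation at the point `s`: `Δ_{-1}[σ(s) ρ(s)] = τ(s) ρ(s)`. -/
def PearsonEqAt (x : ℂ → ℂ) (σt τt : ℂ[X]) (ρ : ℂ → ℂ) (s : ℂ) : Prop :=
  fwdDiv x (-1) (fun t => sigma x σt τt t * ρ t) s = tau x τt s * ρ s

/-- `(1/ρ(s)) Δ_{-n}^{(n)} [ρ(s) ∏_{j=0}^{n-1} σ(s-j)]`. -/
def rodriguesFirst (x : ℂ → ℂ) (σt τt : ℂ[X]) (ρ : ℂ → ℂ) (n : ℕ) : ℂ → ℂ := fun s =>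
  1 / ρ s * fwdDivIter x (-(n : ℤ)) n
    (fun u => ρ u * ∏ j ∈ Finset.range n, sigma x σt τt (u - (j : ℂ))) s

/-- `(1/ρ(s)) Δ_{-n}^{(n)} [ρ(s) ∏_{j=0}^{n-1} σ(s-j)
∫_N^s d_∇ x_{-n}(t) / (ρ(t) ∏_{j=0}^{n} σ(t-j))]`. -/
def rodriguesSecond (x : ℂ → ℂ) (σt τt : ℂ[X]) (ρ : ℂ → ℂ) (n : ℕ) (N : ℂ) : ℂ → ℂ := fun s =>
  1 / ρ s * fwdDivIter x (-(n : ℤ)) n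
    (fun u => ρ u * (∏ j ∈ Finset.range n, sigma x σt τt (u - (j : ℂ))) *
      nablaIntegral x (-(n : ℤ))
        (fun t => 1 / (ρ t * ∏ j ∈ Finset.range (n + 1), sigma x σt τt (t - (j : ℂ)))) N u) s

end NonuniformLattice

end

open Polynomial

namespace NonuniformLattice

noncomputable section

/-! ### Ladder operators for second order difference operators on `ℤ` -/

/-! On `N + ℤ` put `D(j) = x(N + (j+1)/2) - x(N + (j-1)/2)`, `S = σ` and `B = σ + τ ∇x_1`. Equation
(1) then factors as `L_0 R_0 y = -λ y`, where `R_k` (`raising`) is `∇_{-k}` and `L_k` is `lowering`.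
The intertwining relation `R_k L_k = L_{k+1} R_{k+1} + κ_k` (`raising_lowering`) holds with the
constant `κ_k = Δ_k τ_k`, because `τ_k` is affine in `x_k` (`exists_tauK_eq`).

With `μ_k = λ - λ_k`, so that `μ_{k+1} = μ_k + κ_k`, the operator `L_k` maps the solutions of
`L_{k+1} R_{k+1} v = -μ_{k+1} v` to those of `L_k R_k v = -μ_k v`. It is bijective if `μ_k ≠ 0`,
with inverse `-μ_k⁻¹ R_k`. Hence `L_0 ⋯ L_{n-1}` identifies the kernel of `L_n R_n` with the
solutions of (1).

The Pearson equation makes `L_k` a plain difference after multiplication by a weight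
(`weight_mul_lowering`). This solves `L_n R_n v = 0` by constants and one discrete integral, and
turns `L_0 ⋯ L_{n-1}` into the Rodrigues expression. -/

/-- The operator `u ↦ (u(m) - u(m-1)) / D(2m-k-1)`. -/
def raising (D : ℤ → ℂ) (k : ℕ) : (ℤ → ℂ) →ₗ[ℂ] (ℤ → ℂ) where
  toFun u m := (u m - u (m - 1)) / D (2 * m - k - 1)
  map_add' u v := by ext m; simp only [Pi.add_apply]; ring
  map_smul' c u := by
    ext m; simp only [Pi.smul_apply, smul_eq_mul, RingHom.id_apply]; ring

/-- The operator `w ↦ (B(m) w(m+1) - S(m-k) w(m)) / D(2m-k)`. -/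
def lowering (D S B : ℤ → ℂ) (k : ℕ) : (ℤ → ℂ) →ₗ[ℂ] (ℤ → ℂ) where
  toFun w m := (B m * w (m + 1) - S (m - k) * w m) / D (2 * m - k)
  map_add' u v := by ext m; simp only [Pi.add_apply]; ring
  map_smul' c u := by
    ext m; simp only [Pi.smul_apply, smul_eq_mul, RingHom.id_apply]; ring

/-- The composition of the lowering operators with indices `0, …, n-1`. -/
def loweringProd (D S B : ℤ → ℂ) : ℕ → (ℤ → ℂ) →ₗ[ℂ] (ℤ → ℂ)
  | 0 => LinearMap.id
  | n + 1 => loweringProd D S B n ∘ₗ lowering D S B n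

/-- Both compositions have the same coefficients at `w(m+1)` and `w(m-1)`; those at `w(m)` differ by
exactly the expression in `hκ`. -/
theorem raising_lowering {D S B : ℤ → ℂ} {k : ℕ} {κ : ℂ} (hD : ∀ j, D j ≠ 0)
    (hκ : ∀ m : ℤ, ((B m - S (m - k)) / D (2 * m - k)
      - (B (m - 1) - S (m - 1 - k)) / D (2 * (m - 1) - k)) / D (2 * m - k - 1) = κ)
    (w : ℤ → ℂ) :
    raising D k (lowering D S B k w)
      = lowering D S B (k + 1) (raising D (k + 1) w) + κ • w := by
  ext m
  simp only [raising, lowering, LinearMap.coe_mk, AddHom.coe_mk, Pi.add_apply, Pi.smul_apply,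
    smul_eq_mul, ← hκ m]
  have e1 : 2 * (m + 1) - ((k + 1 : ℕ) : ℤ) - 1 = 2 * m - k := by push_cast; ring
  have e2 : 2 * m - ((k + 1 : ℕ) : ℤ) - 1 = 2 * (m - 1) - k := by push_cast; ring
  have e3 : 2 * m - ((k + 1 : ℕ) : ℤ) = 2 * m - k - 1 := by push_cast; ring
  have e4 : m - ((k + 1 : ℕ) : ℤ) = m - 1 - k := by push_cast; ring
  rw [e1, e2, e3, e4, sub_add_cancel, add_sub_cancel_right]
  have h1 := hD (2 * m - k)
  have h2 := hD (2 * (m - 1) - k)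
  have h3 := hD (2 * m - k - 1)
  field_simp
  ring

section Ladder

variable {D S B : ℤ → ℂ} {κ μ : ℕ → ℂ}

/-- The first conclusion makes `raising` a left inverse of `lowering` up to the scalar `-μ k`, which
yields injectivity. -/
theorem lowering_mem_eigenspace (hD : ∀ j, D j ≠ 0) {k : ℕ}
    (hκ : ∀ m : ℤ, ((B m - S (m - k)) / D (2 * m - k)
      - (B (m - 1) - S (m - 1 - k)) / D (2 * (m - 1) - k)) / D (2 * m - k - 1) = κ k)
    (hμ : μ (k + 1) = μ k + κ k) {v : ℤ → ℂ}
    (hv : lowering D S B (k + 1) (raising D (k + 1) v) = -μ (k + 1) • v) :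
    raising D k (lowering D S B k v) = -μ k • v ∧
      lowering D S B k (raising D k (lowering D S B k v)) = -μ k • lowering D S B k v := by
  have h : raising D k (lowering D S B k v) = -μ k • v := by
    rw [raising_lowering hD hκ, hv, hμ, ← add_smul]; congr 1; ring
  exact ⟨h, by rw [h, map_smul]⟩

theorem loweringProd_mem_eigenspace (hD : ∀ j, D j ≠ 0)
    (hκ : ∀ (k : ℕ) (m : ℤ), ((B m - S (m - k)) / D (2 * m - k)
      - (B (m - 1) - S (m - 1 - k)) / D (2 * (m - 1) - k)) / D (2 * m - k - 1) = κ k)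
    (hμ : ∀ k, μ (k + 1) = μ k + κ k) (n : ℕ) {v : ℤ → ℂ}
    (hv : lowering D S B n (raising D n v) = -μ n • v) :
    lowering D S B 0 (raising D 0 (loweringProd D S B n v))
      = -μ 0 • loweringProd D S B n v := by
  induction n generalizing v with
  | zero => exact hv
  | succ n ih => exact ih (lowering_mem_eigenspace hD (hκ n) (hμ n) hv).2

theorem loweringProd_injective (hD : ∀ j, D j ≠ 0)
    (hκ : ∀ (k : ℕ) (m : ℤ), ((B m - S (m - k)) / D (2 * m - k)
      - (B (m - 1) - S (m - 1 - k)) / D (2 * (m - 1) - k)) / D (2 * m - k - 1) = κ k)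
    (hμ : ∀ k, μ (k + 1) = μ k + κ k) (n : ℕ) (hμ0 : ∀ k < n, μ k ≠ 0) {v : ℤ → ℂ}
    (hv : lowering D S B n (raising D n v) = -μ n • v)
    (h0 : loweringProd D S B n v = 0) : v = 0 := by
  induction n generalizing v with
  | zero => exact h0
  | succ n ih =>
    obtain ⟨h1, h2⟩ := lowering_mem_eigenspace hD (hκ n) (hμ n) hv
    have h3 := ih (fun k hk => hμ0 k (hk.trans n.lt_succ_self)) h2 h0
    rw [h3, map_zero] at h1
    exact (smul_eq_zero.mp h1.symm).resolve_left (neg_ne_zero.mpr (hμ0 n n.lt_succ_self))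

/-- At each level the preimage of `v` is `-μ_n⁻¹ R_n v`, by the eigenvalue equation itself. -/
theorem exists_eq_loweringProd (hD : ∀ j, D j ≠ 0)
    (hκ : ∀ (k : ℕ) (m : ℤ), ((B m - S (m - k)) / D (2 * m - k)
      - (B (m - 1) - S (m - 1 - k)) / D (2 * (m - 1) - k)) / D (2 * m - k - 1) = κ k)
    (hμ : ∀ k, μ (k + 1) = μ k + κ k) (n : ℕ) (hμ0 : ∀ k < n, μ k ≠ 0) {y : ℤ → ℂ}
    (hy : lowering D S B 0 (raising D 0 y) = -μ 0 • y) :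
    ∃ v, lowering D S B n (raising D n v) = -μ n • v ∧ y = loweringProd D S B n v := by
  induction n with
  | zero => exact ⟨y, hy, rfl⟩
  | succ n ih =>
    obtain ⟨v, hv, rfl⟩ := ih fun k hk => hμ0 k (hk.trans n.lt_succ_self)
    have hn := neg_ne_zero.mpr (hμ0 n n.lt_succ_self)
    have hT : lowering D S B n ((-μ n)⁻¹ • raising D n v) = v := by
      rw [map_smul, hv, smul_smul, inv_mul_cancel₀ hn, one_smul]
    refine ⟨(-μ n)⁻¹ • raising D n v, ?_, ?_⟩
    · have h := raising_lowering hD (hκ n) ((-μ n)⁻¹ • raising D n v)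
      rw [hT] at h
      rw [← sub_eq_iff_eq_add.mpr h, hμ n, neg_add, add_smul, smul_smul (-μ n),
        mul_inv_cancel₀ hn, one_smul, neg_smul, sub_eq_add_neg]
    · rw [loweringProd, LinearMap.comp_apply, hT]

end Ladder

/-! ### The Pearson weight and the kernel at level `n` -/

theorem eq_of_forall_eq_sub_one {f : ℤ → ℂ} (h : ∀ m, f m = f (m - 1)) (a m : ℤ) :
    f m = f a := by
  induction m using Int.inductionOn' (b := a) with
  | zero => rfl
  | succ k _ ih => rw [h, add_sub_cancel_right, ih]
  | pred k _ ih => rw [← h, ih]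

section Weight

variable {D S B R : ℤ → ℂ}

/-- The weight `R(m) S(m) S(m-1) ⋯ S(m-k+1)`. -/
def weight (R S : ℤ → ℂ) (k : ℕ) (m : ℤ) : ℂ := R m * ∏ j ∈ Finset.range k, S (m - j)

theorem weight_succ (k : ℕ) (m : ℤ) : weight R S (k + 1) m = weight R S k m * S (m - k) := by
  rw [weight, weight, Finset.prod_range_succ, mul_assoc]

theorem weight_ne_zero (hR : ∀ m, R m ≠ 0) (hS : ∀ m, S m ≠ 0) (k : ℕ) (m : ℤ) :
    weight R S k m ≠ 0 :=
  mul_ne_zero (hR m) (Finset.prod_ne_zero_iff.mpr fun _ _ => hS _)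

theorem weight_succ_add_one (hP : ∀ m, S (m + 1) * R (m + 1) = B m * R m) (k : ℕ) (m : ℤ) :
    weight R S (k + 1) (m + 1) = weight R S k m * B m := by
  rw [weight, weight, Finset.prod_range_succ']
  have : ∀ j : ℕ, m + 1 - ((j + 1 : ℕ) : ℤ) = m - j := fun j => by push_cast; ring
  simp only [this, Nat.cast_zero, sub_zero]
  linear_combination (∏ j ∈ Finset.range k, S (m - j)) * hP m

/-- The weight is a summation factor: the Pearson recurrence absorbs `B m` into the weight at `m +
1`, and `S (m - k)` is the next factor of the weight at `m`. -/
theorem weight_mul_lowering (hP : ∀ m, S (m + 1) * R (m + 1) = B m * R m) (k : ℕ)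
    (w : ℤ → ℂ) (m : ℤ) :
    weight R S k m * lowering D S B k w m
      = (weight R S (k + 1) (m + 1) * w (m + 1) - weight R S (k + 1) m * w m)
        / D (2 * m - k) := by
  rw [weight_succ_add_one hP, weight_succ]
  simp only [lowering, LinearMap.coe_mk, AddHom.coe_mk]
  ring

/-- The kernel of `lowering n ∘ raising n` is spanned by the constants and by a function whose
difference is `D(2m-n-1) / weight (n+1) m`. -/
theorem lowering_raising_eq_zero_iff (hD : ∀ j, D j ≠ 0) (hR : ∀ m, R m ≠ 0)
    (hS : ∀ m, S m ≠ 0) (hP : ∀ m, S (m + 1) * R (m + 1) = B m * R m) {n : ℕ} {I : ℤ → ℂ}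
    (hI : ∀ m, I m - I (m - 1) = D (2 * m - n - 1) / weight R S (n + 1) m) (v : ℤ → ℂ) :
    lowering D S B n (raising D n v) = 0 ↔ ∃ C₁ C₂ : ℂ, v = fun m => C₁ + C₂ * I m := by
  have hW := weight_ne_zero hR hS
  constructor
  · intro h
    -- First integral of the equation; summing it once more gives `v`.
    have hconst : ∀ m, weight R S (n + 1) m * raising D n v m
        = weight R S (n + 1) (m - 1) * raising D n v (m - 1) := fun m => by
      have := weight_mul_lowering (D := D) hP n (raising D n v) (m - 1)
      rw [h, Pi.zero_apply, mul_zero, sub_add_cancel, eq_comm, div_eq_zero_iff] at this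
      exact sub_eq_zero.mp (this.resolve_right (hD _))
    set C := weight R S (n + 1) 0 * raising D n v 0 with hC
    have hv : ∀ m, v m - C * I m = v (m - 1) - C * I (m - 1) := fun m => by
      have h1 := eq_of_forall_eq_sub_one hconst 0 m
      rw [← hC] at h1
      simp only [raising, LinearMap.coe_mk, AddHom.coe_mk] at h1
      have h2 : v m - v (m - 1) = C * (I m - I (m - 1)) := by
        rw [hI, ← h1]
        have := hW (n + 1) m
        have := hD (2 * m - n - 1)
        field_simp
      linear_combination h2
    refine ⟨v 0 - C * I 0, C, funext fun m => ?_⟩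
    linear_combination eq_of_forall_eq_sub_one hv 0 m
  · rintro ⟨C₁, C₂, rfl⟩
    ext m
    have hc : ∀ m, weight R S (n + 1) m
        * raising D n (fun m => C₁ + C₂ * I m) m = C₂ := fun m => by
      have h2 : C₁ + C₂ * I m - (C₁ + C₂ * I (m - 1)) = C₂ * (I m - I (m - 1)) := by ring
      simp only [raising, LinearMap.coe_mk, AddHom.coe_mk]
      rw [h2, hI]
      have := hW (n + 1) m
      have := hD (2 * m - n - 1)
      field_simp
    have := weight_mul_lowering (D := D) hP n (raising D n fun m => C₁ + C₂ * I m) m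
    rw [hc, hc, sub_self, zero_div] at this
    exact (mul_eq_zero.mp this).resolve_left (hW n m)

end Weight

/-! ### The coefficients on nonuniform lattices -/

theorem eval_of_natDegree_le_two {p : ℂ[X]} (hp : p.natDegree ≤ 2) (z : ℂ) :
    p.eval z = p.coeff 0 + p.coeff 1 * z + p.coeff 2 * z ^ 2 := by
  rw [eval_eq_sum_range' (Nat.lt_succ_of_le hp)]
  simp [Finset.sum_range_succ]

theorem eval_of_natDegree_le_one {p : ℂ[X]} (hp : p.natDegree ≤ 1) (z : ℂ) :
    p.eval z = p.coeff 0 + p.coeff 1 * z := by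
  rw [eval_eq_sum_range' (Nat.lt_succ_of_le hp)]
  simp [Finset.sum_range_succ]

/-- `τ_k` is a polynomial of degree at most one in `x_k`. -/
theorem exists_tauK_eq {x : ℂ → ℂ} (hx : IsNonuniformLattice x) {σt τt : ℂ[X]}
    (hσt : σt.natDegree ≤ 2) (hτt : τt.natDegree ≤ 1) (k : ℤ) :
    ∃ a b : ℂ, ∀ s, bwd (shift x (k + 1)) s ≠ 0 →
      tauK x σt τt k s = a * shift x k s + b := by
  rcases hx with ⟨q, c₁, c₂, c₃, hq0, -, -, hx⟩ | ⟨c₁, c₂, c₃, -, hx⟩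
  · set p : ℂ := q ^ (1 / 2 : ℂ) with hp
    set P : ℂ := q ^ ((k : ℂ) / 2) with hP
    have hp0 : p ≠ 0 := by simp [hp, Complex.cpow_eq_zero_iff, hq0]
    have hP0 : P ≠ 0 := by simp [hP, Complex.cpow_eq_zero_iff, hq0]
    let g : ℂ := (P - P⁻¹) / (p - p⁻¹)
    let A : ℂ := P + P⁻¹
    let a : ℂ := σt.coeff 2 * g * A + 1 / 2 * τt.coeff 1 * (A ^ 2 - 2)
    refine ⟨a, σt.coeff 1 * g + 2 * σt.coeff 2 * g * c₃ + 1 / 2 * τt.coeff 0 * A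
      + 1 / 2 * τt.coeff 1 * c₃ * A - a * c₃, fun s hs => ?_⟩
    set Q : ℂ := q ^ (s + k / 2) with hQ
    have hX : ∀ t e : ℂ, q ^ t = e → x t = c₁ * e + c₂ * e⁻¹ + c₃ := fun t e he => by
      rw [hx, Complex.cpow_neg, he]
    have x0 := hX (s + k / 2) Q rfl
    have x1 := hX (s + (k + 1) / 2) (Q * p) (by rw [hQ, hp, ← Complex.cpow_add _ _ hq0]; ring_nf)
    have x2 := hX (s - 1 + (k + 1) / 2) (Q / p)
      (by rw [hQ, hp, ← Complex.cpow_sub _ _ hq0]; ring_nf)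
    have x3 := hX (s + k) (Q * P) (by rw [hQ, hP, ← Complex.cpow_add _ _ hq0]; ring_nf)
    have x4 := hX s (Q / P) (by rw [hQ, hP, ← Complex.cpow_sub _ _ hq0]; ring_nf)
    have x5 := hX (s + k + 1 / 2) (Q * P * p)
      (by rw [hQ, hP, hp, ← Complex.cpow_add _ _ hq0, ← Complex.cpow_add _ _ hq0]; ring_nf)
    have x6 := hX (s + k - 1 + 1 / 2) (Q * P / p)
      (by rw [hQ, hP, hp, ← Complex.cpow_add _ _ hq0, ← Complex.cpow_sub _ _ hq0]; ring_nf)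
    have x7 := hX (s + 1 / 2) (Q / P * p)
      (by rw [hQ, hP, hp, ← Complex.cpow_sub _ _ hq0, ← Complex.cpow_add _ _ hq0]; ring_nf)
    have x8 := hX (s - 1 + 1 / 2) (Q / P / p)
      (by rw [hQ, hP, hp, ← Complex.cpow_sub _ _ hq0, ← Complex.cpow_sub _ _ hq0]; ring_nf)
    have hpp : p - p⁻¹ ≠ 0 := fun h => by
      apply hs
      have : p = p⁻¹ := sub_eq_zero.mp h
      simp only [bwd, shift, Int.cast_add, Int.cast_one, x1, x2]
      rw [div_eq_mul_inv, ← this, sub_self]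
    simp only [tauK]
    rw [div_eq_iff hs]
    simp only [bwd, shift, sigma, tau, Int.cast_add, Int.cast_one, x0, x1, x2, x3, x4, x5, x6,
      x7, x8, eval_of_natDegree_le_two hσt, eval_of_natDegree_le_one hτt, a, A]
    have hg : g * (p - p⁻¹) = P - P⁻¹ := div_mul_cancel₀ _ hpp
    have hPi := mul_inv_cancel₀ hP0
    simp only [div_eq_mul_inv, mul_inv, inv_inv]
    linear_combination (-σt.coeff 1 * (c₁ * Q - c₂ * Q⁻¹) - σt.coeff 2 * (c₁ * Q - c₂ * Q⁻¹)
      * ((P + P⁻¹) * (c₁ * Q + c₂ * Q⁻¹) + 2 * c₃)) * hg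
      - τt.coeff 1 * (c₁ * Q + c₂ * Q⁻¹) * ((p - p⁻¹) * (c₁ * Q - c₂ * Q⁻¹)) * hPi
  -- Here `x(s+k) - x(s) = k ∇x_{k+1}(s)` and `x(s+k) + x(s) = 2 x_k(s) + c₁ k²/2`.
  · refine ⟨2 * σt.coeff 2 * k + τt.coeff 1, σt.coeff 1 * k + σt.coeff 2 * k * (c₁ * k ^ 2 / 2)
      + τt.coeff 0 + 3 / 4 * τt.coeff 1 * c₁ * k ^ 2, fun s hs => ?_⟩
    simp only [tauK]
    rw [div_eq_iff hs]
    simp only [bwd, shift, sigma, tau, Int.cast_add, Int.cast_one, hx,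
      eval_of_natDegree_le_two hσt, eval_of_natDegree_le_one hτt]
    ring

/-! ### Oriented sums -/

theorem latticeSum_add_intCast (f : ℂ → ℂ) (N : ℂ) (m : ℤ) :
    latticeSum f N (N + m) = ∑ i ∈ Finset.Icc 0 m, f (N + (i : ℂ))
      - ∑ i ∈ Finset.Icc (m + 1) (-1), f (N + (i : ℂ)) := by
  simp [latticeSum]

theorem latticeSum_sub (f : ℂ → ℂ) (N : ℂ) (m : ℤ) :
    latticeSum f N (N + m) - latticeSum f N (N + (m - 1 : ℤ)) = f (N + m) := by
  simp only [latticeSum_add_intCast, sub_add_cancel]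
  rcases le_or_gt 0 m with hm | hm
  · rw [Finset.Icc_eq_empty (a := m + 1) (by omega), Finset.Icc_eq_empty (a := m) (by omega),
      ← Finset.insert_Icc_sub_one_right_eq_Icc hm, Finset.sum_insert (by simp)]
    simp
  · rw [Finset.Icc_eq_empty (b := m) (by omega), Finset.Icc_eq_empty (b := m - 1) (by omega),
      ← Finset.insert_Icc_add_one_left_eq_Icc (a := m) (by omega), Finset.sum_insert (by simp)]
    simp

theorem latticeSum_sub_one (f : ℂ → ℂ) (N : ℂ) : latticeSum f N (N + (-1 : ℤ)) = 0 := by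
  rw [latticeSum_add_intCast]; simp

/-! ### Difference operators restricted to `N + ℤ` -/

/-- The increment of `x` across `N + j/2`. -/
def latticeStep (x : ℂ → ℂ) (N : ℂ) (j : ℤ) : ℂ :=
  x (N + (j + 1) / 2) - x (N + (j - 1) / 2)

theorem fwd_shift_eq (x : ℂ → ℂ) (N : ℂ) (k m : ℤ) :
    fwd (shift x k) (N + m) = latticeStep x N (2 * m + k + 1) := by
  simp only [fwd, shift, latticeStep]
  congr 2 <;> push_cast <;> ring

theorem bwd_shift_eq (x : ℂ → ℂ) (N : ℂ) (k m : ℤ) :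
    bwd (shift x k) (N + m) = latticeStep x N (2 * m + k - 1) := by
  simp only [bwd, shift, latticeStep]
  congr 2 <;> push_cast <;> ring

theorem fwdDiv_eq (x : ℂ → ℂ) (N : ℂ) (k m : ℤ) (f : ℂ → ℂ) :
    fwdDiv x k f (N + m)
      = (f (N + (m + 1 : ℤ)) - f (N + m)) / latticeStep x N (2 * m + k + 1) := by
  rw [fwdDiv, fwd_shift_eq, fwd]; push_cast; rw [add_assoc]

theorem bwdDiv_eq (x : ℂ → ℂ) (N : ℂ) (k m : ℤ) (f : ℂ → ℂ) :
    bwdDiv x k f (N + m)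
      = (f (N + m) - f (N + (m - 1 : ℤ))) / latticeStep x N (2 * m + k - 1) := by
  rw [bwdDiv, bwd_shift_eq, bwd]; push_cast; rw [add_sub_assoc]

/-- Peels off the innermost difference, matching `loweringProd`, whose last factor acts first. -/
theorem fwdDivIter_succ' (x : ℂ → ℂ) (k : ℤ) (n : ℕ) (f : ℂ → ℂ) :
    fwdDivIter x k (n + 1) f = fwdDivIter x (k + 1) n (fwdDiv x k f) := by
  induction n with
  | zero => simp [fwdDivIter]
  | succ n ih =>
    rw [fwdDivIter, ih, fwdDivIter]
    congr 1
    push_cast; ring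

theorem fwdDivIter_eq_weight_mul_loweringProd {x : ℂ → ℂ} {N : ℂ} {S B R : ℤ → ℂ}
    (hP : ∀ m, S (m + 1) * R (m + 1) = B m * R m) (n : ℕ) (v : ℤ → ℂ) (f : ℂ → ℂ)
    (hf : ∀ m : ℤ, f (N + m) = weight R S n m * v m) (m : ℤ) :
    fwdDivIter x (-(n : ℤ)) n f (N + m)
      = R m * loweringProd (latticeStep x N) S B n v m := by
  induction n generalizing v f with
  | zero => simpa [weight, fwdDivIter, loweringProd] using hf m
  | succ n ih =>
    have hk : (-((n + 1 : ℕ) : ℤ)) + 1 = -(n : ℤ) := by push_cast; ring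
    rw [fwdDivIter_succ', hk]
    refine ih (lowering (latticeStep x N) S B n v) _ fun m => ?_
    rw [weight_mul_lowering hP, fwdDiv_eq, hf, hf]
    congr 2
    push_cast; ring

theorem raising_zero_apply (x : ℂ → ℂ) (N : ℂ) (y : ℂ → ℂ) (m : ℤ) :
    raising (latticeStep x N) 0 (fun i : ℤ => y (N + i)) m = bwdDiv x 0 y (N + m) := by
  rw [bwdDiv_eq]; simp [raising]

/-- The coefficient `σ + τ ∇ x_1`. -/
def sigmaAddTau (x : ℂ → ℂ) (σt τt : ℂ[X]) : ℂ → ℂ :=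
  fun s => sigma x σt τt s + tau x τt s * bwd (shift x 1) s

/-- Since `∇x_1 = Δx_{-1}`, collecting terms gives `Δ_0 y` the coefficient `(σ + τ ∇x_1)/∇x_1` and
`∇_0 y` the coefficient `-σ/∇x_1`. -/
theorem hypergeometricEqAt_iff {x : ℂ → ℂ} {σt τt : ℂ[X]} {lam N : ℂ}
    (hD : ∀ j, latticeStep x N j ≠ 0) (y : ℂ → ℂ) (m : ℤ) :
    HypergeometricEqAt x σt τt lam y (N + m) ↔
      lowering (latticeStep x N) (fun i => sigma x σt τt (N + i))
        (fun i => sigmaAddTau x σt τt (N + i)) 0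
        (raising (latticeStep x N) 0 fun i : ℤ => y (N + i)) m = -lam * y (N + m) := by
  have h0 : fwdDiv x 0 y (N + m) = bwdDiv x 0 y (N + (m + 1 : ℤ)) := by
    rw [fwdDiv_eq, bwdDiv_eq]; congr 2 <;> ring_nf
  have hb : bwd (shift x 1) (N + m) = latticeStep x N (2 * m) := by
    rw [bwd_shift_eq]; congr 1; ring
  have hf : ∀ f, fwdDiv x (-1) f (N + m)
      = (f (N + (m + 1 : ℤ)) - f (N + m)) / latticeStep x N (2 * m) := fun f => by
    rw [fwdDiv_eq]; congr 2; ring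
  simp only [HypergeometricEqAt, lowering, LinearMap.coe_mk, AddHom.coe_mk, raising_zero_apply,
    h0, hf, sigmaAddTau, sigma, tau, hb, Nat.cast_zero, sub_zero]
  have := hD (2 * m)
  rw [← sub_eq_zero (b := -lam * _)]
  refine Eq.congr ?_ rfl
  field_simp
  ring

theorem fwdDiv_tauK_eq {x : ℂ → ℂ} (hx : IsNonuniformLattice x) {σt τt : ℂ[X]}
    (hσt : σt.natDegree ≤ 2) (hτt : τt.natDegree ≤ 1) {N : ℂ}
    (hD : ∀ j, latticeStep x N j ≠ 0) (k m : ℤ) :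
    fwdDiv x k (tauK x σt τt k) (N + m) = fwdDiv x k (tauK x σt τt k) N := by
  obtain ⟨a, b, hab⟩ := exists_tauK_eq hx hσt hτt k
  have h : ∀ m : ℤ, fwdDiv x k (tauK x σt τt k) (N + m) = a := fun m => by
    rw [fwdDiv, div_eq_iff (by rw [fwd_shift_eq]; exact hD _), fwd, fwd, hab, hab]
    · ring
    · rw [bwd_shift_eq]; exact hD _
    · have : N + (m : ℂ) + 1 = N + (m + 1 : ℤ) := by push_cast; ring
      rw [this, bwd_shift_eq]; exact hD _
  rw [h, ← h 0, Int.cast_zero, add_zero]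

theorem tauK_eq (x : ℂ → ℂ) (σt τt : ℂ[X]) (N : ℂ) (k m : ℤ) :
    tauK x σt τt k (N + (m - k : ℤ))
      = (sigmaAddTau x σt τt (N + m) - sigma x σt τt (N + (m - k : ℤ)))
        / latticeStep x N (2 * m - k) := by
  have h : N + ((m - k : ℤ) : ℂ) + k = N + m := by push_cast; ring
  have h' : 2 * (m - k) + (k + 1) - 1 = 2 * m - k := by ring
  rw [tauK, h, bwd_shift_eq x N (k + 1), h', sigmaAddTau]
  congr 1; ring

/-- The two quotients are `τ_k` at `N + m - k` and at `N + m - 1 - k`, so the left side is `Δ_k τ_k`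
at the latter point. -/
theorem tauK_difference {x : ℂ → ℂ} (hx : IsNonuniformLattice x) {σt τt : ℂ[X]}
    (hσt : σt.natDegree ≤ 2) (hτt : τt.natDegree ≤ 1) {N : ℂ}
    (hD : ∀ j, latticeStep x N j ≠ 0) (k : ℕ) (m : ℤ) :
    ((sigmaAddTau x σt τt (N + m) - sigma x σt τt (N + (m - k : ℤ)))
          / latticeStep x N (2 * m - k)
        - (sigmaAddTau x σt τt (N + (m - 1 : ℤ)) - sigma x σt τt (N + (m - 1 - k : ℤ)))
          / latticeStep x N (2 * (m - 1) - k)) / latticeStep x N (2 * m - k - 1)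
      = fwdDiv x k (tauK x σt τt k) N := by
  rw [← fwdDiv_tauK_eq hx hσt hτt hD k (m - 1 - k), fwdDiv_eq]
  have h : m - 1 - (k : ℤ) + 1 = m - k := by ring
  have h' : 2 * (m - 1 - (k : ℤ)) + k + 1 = 2 * m - k - 1 := by ring
  rw [h, h', ← tauK_eq x σt τt N k m, ← tauK_eq x σt τt N k (m - 1)]

theorem pearson_recurrence {x : ℂ → ℂ} {σt τt : ℂ[X]} {ρ : ℂ → ℂ} {N : ℂ}
    (hD : ∀ j, latticeStep x N j ≠ 0) {m : ℤ} (h : PearsonEqAt x σt τt ρ (N + m)) :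
    sigma x σt τt (N + (m + 1 : ℤ)) * ρ (N + (m + 1 : ℤ))
      = sigmaAddTau x σt τt (N + m) * ρ (N + m) := by
  have h1 : 2 * m + -1 + 1 = 2 * m := by ring
  have h2 : 2 * m + 1 - 1 = 2 * m := by ring
  rw [PearsonEqAt, fwdDiv_eq, h1, div_eq_iff (hD _)] at h
  rw [sigmaAddTau, bwd_shift_eq, h2]
  linear_combination h

end

end NonuniformLattice

/-! ### The general solution -/

open NonuniformLattice in
theorem mainTheorem1
    (x : ℂ → ℂ) (hx : NonuniformLattice.IsNonuniformLattice x)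
    (σt τt : Polynomial ℂ) (hσt : σt.natDegree ≤ 2) (hτt : τt.natDegree ≤ 1)
    (lam : ℂ) (ρ : ℂ → ℂ) (N : ℂ) (n : ℕ)
    -- the denominators that occur are nonzero at the points of `N + ℤ`
    (hΔx : ∀ k m : ℤ, NonuniformLattice.fwd (NonuniformLattice.shift x k) (N + m) ≠ 0)
    (hσ : ∀ m : ℤ, NonuniformLattice.sigma x σt τt (N + m) ≠ 0)
    (hρ : ∀ m : ℤ, ρ (N + m) ≠ 0)
    (hPearson : ∀ m : ℤ, NonuniformLattice.PearsonEqAt x σt τt ρ (N + m))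
    (hlam : lam = NonuniformLattice.eigenvalue x σt τt n N)
    (hne : ∀ m < n, NonuniformLattice.eigenvalue x σt τt m N ≠
      NonuniformLattice.eigenvalue x σt τt n N) :
    -- the two-parameter family consists of all solutions on `N + ℤ`
    (∀ y : ℂ → ℂ,
      (∀ m : ℤ, NonuniformLattice.HypergeometricEqAt x σt τt lam y (N + m)) ↔
        ∃ C₁ C₂ : ℂ, ∀ m : ℤ,
          y (N + m) = C₁ * NonuniformLattice.rodriguesFirst x σt τt ρ n (N + m)
            + C₂ * NonuniformLattice.rodriguesSecond x σt τt ρ n N (N + m)) ∧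
    -- and the two members of the family are linearly independent on `N + ℤ`
    (∀ C₁ C₂ : ℂ,
      (∀ m : ℤ, C₁ * NonuniformLattice.rodriguesFirst x σt τt ρ n (N + m)
          + C₂ * NonuniformLattice.rodriguesSecond x σt τt ρ n N (N + m) = 0) →
        C₁ = 0 ∧ C₂ = 0) := by
  have hD : ∀ j, latticeStep x N j ≠ 0 := fun j => by
    have := hΔx (j - 1) 0
    rwa [fwd_shift_eq, show 2 * 0 + (j - 1) + 1 = j by ring] at this
  let S : ℤ → ℂ := fun m => sigma x σt τt (N + m)
  let B : ℤ → ℂ := fun m => sigmaAddTau x σt τt (N + m)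
  let R : ℤ → ℂ := fun m => ρ (N + m)
  let g : ℂ → ℂ := fun t => 1 / (ρ t * ∏ j ∈ Finset.range (n + 1), sigma x σt τt (t - (j : ℂ)))
  let I : ℤ → ℂ := fun m => nablaIntegral x (-(n : ℤ)) g N (N + m)
  let κ : ℕ → ℂ := fun k => fwdDiv x k (tauK x σt τt k) N
  let μ : ℕ → ℂ := fun k => lam - eigenvalue x σt τt k N
  have hP : ∀ m, S (m + 1) * R (m + 1) = B m * R m := fun m =>
    pearson_recurrence hD (hPearson m)
  have hκ : ∀ (k : ℕ) (m : ℤ), ((B m - S (m - k)) / latticeStep x N (2 * m - k)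
      - (B (m - 1) - S (m - 1 - k)) / latticeStep x N (2 * (m - 1) - k))
        / latticeStep x N (2 * m - k - 1) = κ k := tauK_difference hx hσt hτt hD
  have hμ : ∀ k, μ (k + 1) = μ k + κ k := fun k => by
    simp only [μ, κ, eigenvalue, Finset.sum_range_succ]; ring
  have hinj := fun v => loweringProd_injective (v := v) hD hκ hμ n
  have hsurj := fun y => exists_eq_loweringProd (y := y) hD hκ hμ n
  have hmem := fun v => loweringProd_mem_eigenspace (v := v) hD hκ hμ n
  have hμn : μ n = 0 := sub_eq_zero.mpr hlam
  have hμ0 : ∀ k < n, μ k ≠ 0 := fun k hk h => hne k hk (by rw [← hlam, sub_eq_zero.mp h])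
  have hμ_zero : μ 0 = lam := by simp [μ, eigenvalue]
  have hsub : ∀ (m : ℤ) (j : ℕ), N + (m : ℂ) - j = N + (m - j : ℤ) := fun m j => by
    push_cast; ring
  have hI : ∀ m, I m - I (m - 1) = latticeStep x N (2 * m - n - 1) / weight R S (n + 1) m := by
    intro m
    simp only [I, nablaIntegral, latticeSum_sub, bwd_shift_eq, g, hsub]
    rw [one_div_mul_eq_div]
    rfl
  have hker := lowering_raising_eq_zero_iff hD hρ hσ hP hI
  have heig : ∀ v, lowering (latticeStep x N) S B n (raising (latticeStep x N) n v) = -μ n • v ↔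
      ∃ C₁ C₂ : ℂ, v = fun m => C₁ + C₂ * I m := fun v => by
    rw [hμn, neg_zero, zero_smul]; exact hker v
  have hfirst : ∀ m : ℤ, rodriguesFirst x σt τt ρ n (N + m)
      = loweringProd (latticeStep x N) S B n 1 m := fun m => by
    rw [rodriguesFirst, fwdDivIter_eq_weight_mul_loweringProd hP n 1, one_div_mul_eq_div,
      mul_div_cancel_left₀ _ (hρ m)]
    intro m
    simp only [hsub, Pi.one_apply, mul_one]
    rfl
  have hsecond : ∀ m : ℤ, rodriguesSecond x σt τt ρ n N (N + m)
      = loweringProd (latticeStep x N) S B n I m := fun m => by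
    rw [rodriguesSecond, fwdDivIter_eq_weight_mul_loweringProd hP n I, one_div_mul_eq_div,
      mul_div_cancel_left₀ _ (hρ m)]
    intro m
    simp only [hsub]
    rfl
  have hcomb : ∀ C₁ C₂ : ℂ, loweringProd (latticeStep x N) S B n (fun m => C₁ + C₂ * I m)
      = fun m : ℤ => C₁ * rodriguesFirst x σt τt ρ n (N + m)
        + C₂ * rodriguesSecond x σt τt ρ n N (N + m) := fun C₁ C₂ => by
    have : (fun m => C₁ + C₂ * I m) = C₁ • (1 : ℤ → ℂ) + C₂ • I := by ext m; simp
    rw [this, map_add, map_smul, map_smul]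
    ext m
    simp [hfirst, hsecond]
  have hI0 : I (-1) = 0 := by simp only [I, nablaIntegral, latticeSum_sub_one]
  have heq : ∀ y : ℂ → ℂ, (∀ m : ℤ, HypergeometricEqAt x σt τt lam y (N + m)) ↔
      lowering (latticeStep x N) S B 0 (raising (latticeStep x N) 0 fun i : ℤ => y (N + i))
        = -μ 0 • fun i : ℤ => y (N + i) := fun y => by
    rw [hμ_zero, funext_iff]
    exact forall_congr' fun m => hypergeometricEqAt_iff hD y m
  have hWne : ∀ k m, weight R S k m ≠ 0 := weight_ne_zero hρ hσ
  clear_value S B R I κ μ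
  refine ⟨fun y => ?_, fun C₁ C₂ h => ?_⟩
  · rw [heq]
    constructor
    · intro h
      obtain ⟨v, hv, hy⟩ := hsurj _ hμ0 h
      obtain ⟨C₁, C₂, rfl⟩ := (heig v).mp hv
      exact ⟨C₁, C₂, fun m => congrFun (hy.trans (hcomb C₁ C₂)) m⟩
    · rintro ⟨C₁, C₂, h⟩
      have hy : (fun i : ℤ => y (N + i))
          = loweringProd (latticeStep x N) S B n (fun m => C₁ + C₂ * I m) := by
        rw [hcomb]; exact funext h
      rw [hy]
      exact hmem _ ((heig _).mpr ⟨C₁, C₂, rfl⟩)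
  -- By injectivity `C₁ + C₂ I` vanishes identically. The empty sum `I (-1) = 0` forces `C₁ = 0`;
  -- then `I 0`, a single nonzero term, forces `C₂ = 0`.
  · have hv := hinj _ hμ0 ((heig _).mpr ⟨C₁, C₂, rfl⟩)
      ((hcomb C₁ C₂).trans (funext h))
    have h1 : C₁ + C₂ * I (-1) = 0 := congrFun hv (-1)
    have h2 : C₁ + C₂ * I 0 = 0 := congrFun hv 0
    rw [hI0, mul_zero, add_zero] at h1
    rw [h1, zero_add] at h2
    refine ⟨h1, (mul_eq_zero.mp h2).resolve_right ?_⟩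
    have h3 := hI 0
    rw [zero_sub, hI0, sub_zero] at h3
    rw [h3]
    exact div_ne_zero (hD _) (hWne _ _)
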